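/- **Tangential recovery on manifolds as noise vanishes.** Let $K\subset\mathbb R^d$ be compact, $c(x,y)=\tfrac12|x-y|^2$, and let $\nu,\mu,\mu_\varepsilon\in\mathcal P(K)$ $(\varepsilon>0)$ satisfy $\mu_\varepsilon\ll\mathcal L^d$ for every $\varepsilon>0$ and $\mu_\varepsilon\rightharpoonup\mu$ as $\varepsilon\downarrow0$. For $V\in C(K)$ put $V^c(x)=\inf_{y\in K}[c(x,y)-V(y)]$ for $x\in\mathbb R^d$ and $V^{cc}(y)=\inf_{x\in K}[c(x,y)-V^c(x)]$ for $y\in K$. For source measure $\rho\in\mathcal P(K)$ and a Borel map $T:K\to K$ put $$\mathcal L_\rho(V,T)=\int_K \bigl[c(x,T(x))-V(T(x))\bigr]\,d\rho(x)+\int_K V\,d\nu .$$ For each $\varepsilon>0$ let $(V_\varepsilon,T_\varepsilon)$ be an optimal solution of $\sup_{V\in C(K)}\inf_{T:K\to K}\mathcal L_{\mu_\varepsilon}(V,T)$, i.e. $V_\varepsilon\in\operatorname{argmax}_{V\in C(K)}\inf_T\mathcal L_{\mu_\varepsilon}(V,T)$ and $T_\varepsilon\in\operatorname{argmin}_T\mathcal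 L_{\mu_\varepsilon}(V_\varepsilon,T)$. Call $V_0\in C(K)$ a *limiting potential* if there are $\varepsilon_k\downarrow0$ and normalizing constants $a_k\in\mathbb R$ such that $V_{\varepsilon_k}^{cc}+a_k\to V_0$ and $V_{\varepsilon_k}^{c}-a_k\to V_0^c$ uniformly on $K$. Assume moreover that $\mathcal M\subset\mathbb R^d$ is a smooth compact embedded manifold (without boundary) of dimension $m$ with $\mu\ll\mathcal H^m\llcorner\mathcal M$. Then a limiting potential exists, and every limiting potential $V_0$ is a semi-dual optimizer for $(\mu,\nu)$: $V_0\in\operatorname{argmax}_{V\in C(K)}\inf_{T:K\to K}\mathcal L_\mu(V,T)$. Moreover, if $T_{\mathrm{opt}}:K\to K$ is an optimal transport map from $\mu$ to $\nu$, i.e. a minimizer of $\int_K c(x,T(x))\,d\mu(x)$ among all Borel maps $T:K\to K$ with $T_\#\mu=\nu$, then for $\mu$-a.e. $x\in\mathcal M$ the restriction $V_0^c|_{\mathcal M}$ is differentiable at $x$ and $$\nabla_{\mathcal M}V_0^c(x)=\Pi_{T_x\mathcal M}\,\nabla_x c\bigl(x,T_{\mathrm{opt}}(x)\bigr),$$ where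 $\nabla_{\mathcal M}$ is the tangential gradient on $\mathcal M$ and $\Pi_{T_x\mathcal M}$ the orthogonal projection onto the tangent space $T_x\mathcal M$. -/

import Mathlib

open MeasureTheory Filter Topology
open scoped ContDiff

noncomputable section

namespace SemiDualOT

/-- The quadratic cost `c(x, y) = ½ |x - y|²` on `ℝ^d`. -/
def cost {d : ℕ} (x y : EuclideanSpace ℝ (Fin d)) : ℝ := (1 / 2) * ‖x - y‖ ^ 2

variable {d : ℕ} {K : Set (EuclideanSpace ℝ (Fin d))}

/-- The `c`-transform `V^c(x) = inf_{y ∈ K} [c(x, y) - V(y)]` of a function `V` on `K`. The formula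
makes sense at every point `x` of `ℝ^d`. -/
def cTransform (V : K → ℝ) (x : EuclideanSpace ℝ (Fin d)) : ℝ :=
  ⨅ y : K, (cost x y - V y)

/-- The double transform `V^{cc}` on `K`. As the cost is symmetric and both spaces are `K`, it is
given by the same formula `V^{cc}(y) = inf_{x ∈ K} [c(x, y) - V^c(x)]`. -/
def ccTransform (V : K → ℝ) (y : K) : ℝ :=
  cTransform (fun x : K => cTransform V x) y

/-- The semi-dual objective
`L(V, T) = ∫ (c(x, T(x)) - V(T(x))) dμ(x) + ∫ V(y) dν(y)`. -/
def objective (μ ν : ProbabilityMeasure K) (V : C(K, ℝ)) (T : K → K) : ℝ :=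
  ∫ x : K, (cost (x : EuclideanSpace ℝ (Fin d)) (T x) - V (T x)) ∂(μ : Measure K)
    + ∫ y : K, V y ∂(ν : Measure K)

/-- The inner value `inf_T L(V, T)`, over all Borel maps `T : K → K`. -/
def innerValue (μ ν : ProbabilityMeasure K) (V : C(K, ℝ)) : ℝ :=
  ⨅ T : {T : K → K // Measurable T}, objective μ ν V T

/-- `V ∈ argmax_{W ∈ C(K)} inf_T L(W, T)`: the potential `V` is a semi-dual optimizer. -/
def IsOptimalPotential (μ ν : ProbabilityMeasure K) (V : C(K, ℝ)) : Prop :=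
  ∀ W : C(K, ℝ), innerValue μ ν W ≤ innerValue μ ν V

/-- `(V, T)` is an optimal solution of the max-min problem `sup_V inf_T L(V, T)`:
`V ∈ argmax_W inf_S L(W, S)` and `T ∈ argmin_S L(V, S)`. -/
structure IsOptimalPair (μ ν : ProbabilityMeasure K) (V : C(K, ℝ)) (T : K → K) : Prop where
  potential : IsOptimalPotential μ ν V
  measurable : Measurable T
  map_le : ∀ S : K → K, Measurable S → objective μ ν V T ≤ objective μ ν V S

/-- `T` is an optimal transport (Monge) map from `μ` to `ν`: it minimizes `∫ c(x, T(x)) dμ(x)`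
among all Borel maps that push `μ` forward to `ν`. -/
structure IsOptimalMap (μ ν : ProbabilityMeasure K) (T : K → K) : Prop where
  measurable : Measurable T
  map_eq : (μ : Measure K).map T = (ν : Measure K)
  cost_le : ∀ S : K → K, Measurable S → (μ : Measure K).map S = (ν : Measure K) →
    ∫ x : K, cost (x : EuclideanSpace ℝ (Fin d)) (T x) ∂(μ : Measure K)
      ≤ ∫ x : K, cost (x : EuclideanSpace ℝ (Fin d)) (S x) ∂(μ : Measure K)

/-- `V₀` is a limiting potential of the family `(V_ε)_{ε > 0}`: along some `ε_k ↓ 0` one has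
`V_{ε_k}^{cc} → V₀` and `V_{ε_k}^c → V₀^c` uniformly on `K`. Potentials are only determined up to
additive constants, and convergence is understood after a normalization: `V_{ε_k}` is replaced by
`V_{ε_k} + a_k`, which turns `V_{ε_k}^{cc}` into `V_{ε_k}^{cc} + a_k` and `V_{ε_k}^c` into
`V_{ε_k}^c - a_k`. Every choice of the constants `a_k` is admitted, in particular `a_k = 0`. -/
def IsLimitingPotential (V : ℝ → C(K, ℝ)) (V₀ : C(K, ℝ)) : Prop :=
  ∃ (ε : ℕ → ℝ) (a : ℕ → ℝ), Tendsto ε atTop (𝓝[>] 0) ∧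
    TendstoUniformly (fun (k : ℕ) (y : K) => ccTransform (V (ε k)) y + a k) V₀ atTop ∧
    TendstoUniformly (fun (k : ℕ) (x : K) => cTransform (V (ε k)) x - a k)
      (fun x : K => cTransform V₀ x) atTop

/-- `M ⊆ ℝ^d` is a smooth embedded submanifold of dimension `m` (without boundary): around each of
its points there is a smooth chart `Φ` of `ℝ^d` that carries `M` to an `m`-dimensional linear
subspace `L`. -/
def IsSmoothSubmanifold (m : ℕ) (M : Set (EuclideanSpace ℝ (Fin d))) : Prop :=
  ∀ x ∈ M, ∃ (Φ : OpenPartialHomeomorph (EuclideanSpace ℝ (Fin d)) (EuclideanSpace ℝ (Fin d)))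
    (L : Submodule ℝ (EuclideanSpace ℝ (Fin d))),
    x ∈ Φ.source ∧ ContDiffOn ℝ ∞ Φ Φ.source ∧ ContDiffOn ℝ ∞ Φ.symm Φ.target ∧
    Module.finrank ℝ L = m ∧ ∀ y ∈ Φ.source, y ∈ M ↔ Φ y ∈ L

/-- The tangent space `T_x M`: velocities at time `0` of smooth curves in `M` through `x`. (At a
point of a smooth submanifold these already form a linear subspace, so that the span adds
nothing.) -/
def tangentSpaceAt (M : Set (EuclideanSpace ℝ (Fin d))) (x : EuclideanSpace ℝ (Fin d)) :
    Submodule ℝ (EuclideanSpace ℝ (Fin d)) :=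
  Submodule.span ℝ {v | ∃ γ : ℝ → EuclideanSpace ℝ (Fin d), ContDiffAt ℝ ∞ γ 0 ∧ γ 0 = x ∧
    (∀ᶠ t in 𝓝 (0 : ℝ), γ t ∈ M) ∧ deriv γ 0 = v}

/-- The restriction of `φ` to `M` is differentiable at `x`, with tangential gradient
`∇_M φ(x) = g`: the vector `g` lies in `T_x M`, and
`φ(y) = φ(x) + ⟨g, y - x⟩ + o(|y - x|)` as `y → x` within `M`. -/
def HasTangentialGradientAt (M : Set (EuclideanSpace ℝ (Fin d)))
    (φ : EuclideanSpace ℝ (Fin d) → ℝ) (g x : EuclideanSpace ℝ (Fin d)) : Prop :=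
  g ∈ tangentSpaceAt M x ∧ HasGradientWithinAt φ g M x

end SemiDualOT

end

noncomputable section

namespace SemiDualOT

/-! Selecting near-minimizers measurably turns the inner infimum over Borel maps into `semiDual`,
i.e. `∫ V^c dμ + ∫ V dν` (`innerValue_eq`). Passing from `V` to `V^cc` does not lower this
functional, and constants cancel. All `c`-transforms on `K` share one Lipschitz constant, so after
normalization Arzelà–Ascoli yields a limiting potential. Since `με ⇀ μ` and the transforms converge
uniformly, optimality passes to the limit (`IsLimitingPotential.isOptimalPotential`).

For the gradient, `V₀^c - ½|x|²` is Lipschitz, so Rademacher's theorem in charts makes `V₀^c`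
differentiable along `M` at `ℋᵐ`-almost every point. If `m > 0`, then `μ` has no atoms, and there is
no gap between the semi-dual maximum and the Monge minimum: Kantorovich duality (Hahn–Banach and
Riesz) gives a plan attaining the semi-dual value, and maps approximate its cost. Hence `V₀^c(x) +
V₀(T x) = c(x, T x)` almost everywhere (`ae_conj_add_eq_cost`). So `y ↦ c(y, T x) - V₀(T x)` touches
`V₀^c` from above at `x`, and the two have equal derivatives along `M`. If `m = 0`, the tangent
space is trivial and slackness is not needed. -/

lemma integrable_continuousMap {X : Type*} [TopologicalSpace X] [CompactSpace X]
    [MeasurableSpace X] [BorelSpace X] (μ : Measure X) [IsFiniteMeasure μ] (f : C(X, ℝ)) :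
    Integrable (⇑f) μ :=
  f.continuous.integrable_of_hasCompactSupport (HasCompactSupport.of_compactSpace _)

/-! ### The `c`-transform and the semi-dual functional. -/

section Transform

variable {d : ℕ} {K : Set (EuclideanSpace ℝ (Fin d))}

@[fun_prop]
lemma continuous_cost {X : Type*} [TopologicalSpace X] {f g : X → EuclideanSpace ℝ (Fin d)}
    (hf : Continuous f) (hg : Continuous g) : Continuous fun z => cost (f z) (g z) := by
  unfold cost; fun_prop

lemma cost_comm (x y : EuclideanSpace ℝ (Fin d)) : cost x y = cost y x := by
  simp [cost, norm_sub_rev]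

lemma cost_eq (x y : EuclideanSpace ℝ (Fin d)) :
    cost x y = 1 / 2 * ‖x‖ ^ 2 - inner ℝ x y + 1 / 2 * ‖y‖ ^ 2 := by
  rw [cost, norm_sub_sq_real]; ring

variable [CompactSpace K]

lemma exists_norm_bound (K : Set (EuclideanSpace ℝ (Fin d))) [CompactSpace K] :
    ∃ R : NNReal, ∀ x ∈ K, ‖x‖ ≤ R := by
  obtain ⟨R, hR⟩ := (isCompact_iff_compactSpace.2 ‹CompactSpace K›).isBounded.exists_norm_le
  exact ⟨R.toNNReal, fun x hx => (hR x hx).trans (Real.le_coe_toNNReal R)⟩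

lemma bddBelow_cost_sub (V : C(K, ℝ)) (x : EuclideanSpace ℝ (Fin d)) :
    BddBelow (Set.range fun y : K => cost x y - V y) := by
  refine (isCompact_range (f := fun y : K => cost x y - V y) ?_).bddBelow
  fun_prop

lemma cTransform_le (V : C(K, ℝ)) (x : EuclideanSpace ℝ (Fin d)) (y : K) :
    cTransform V x ≤ cost x y - V y :=
  ciInf_le (bddBelow_cost_sub V x) y

lemma integrable_comp_prodMk (μ : ProbabilityMeasure K) {S : K → K} (hS : Measurable S)
    {f : K × K → ℝ} (hf : Continuous f) : Integrable (fun x => f (x, S x)) (μ : Measure K) := by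
  obtain ⟨C, hC⟩ := (isCompact_range hf).isBounded.exists_norm_le
  refine Integrable.of_bound (C := C)
    (hf.measurable.comp (measurable_id.prodMk hS)).aestronglyMeasurable ?_
  exact .of_forall fun x => hC _ ⟨_, rfl⟩

variable [Nonempty K]

/-- Expanding the square, `V^c(x) - ½|x|²` is the infimum over `y ∈ K` of the affine functions `-⟨x,
y⟩ + ½|y|² - V(y)`, whose slopes are bounded by `R`. -/
lemma cTransform_sub_le {R : NNReal} (hR : ∀ x ∈ K, ‖x‖ ≤ R) (V : C(K, ℝ))
    (x x' : EuclideanSpace ℝ (Fin d)) :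
    cTransform V x - 1 / 2 * ‖x‖ ^ 2 ≤ cTransform V x' - 1 / 2 * ‖x'‖ ^ 2 + R * ‖x - x'‖ := by
  suffices cTransform V x - 1 / 2 * ‖x‖ ^ 2 + 1 / 2 * ‖x'‖ ^ 2 - R * ‖x - x'‖ ≤ cTransform V x' by
    linarith
  refine le_ciInf fun y => ?_
  have h1 := cTransform_le V x y
  have h2 : -inner ℝ (x - x') (y : EuclideanSpace ℝ (Fin d)) ≤ R * ‖x - x'‖ := by
    have := abs_le.1 (abs_real_inner_le_norm (x - x') (y : EuclideanSpace ℝ (Fin d)))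
    have h3 : ‖x - x'‖ * ‖(y : EuclideanSpace ℝ (Fin d))‖ ≤ ‖x - x'‖ * R :=
      mul_le_mul_of_nonneg_left (hR y y.2) (norm_nonneg _)
    linarith
  rw [cost_eq] at h1 ⊢
  rw [inner_sub_left] at h2
  linarith

/-- A `c`-transform is, up to the smooth function `½ |x|²`, globally Lipschitz. -/
lemma lipschitzWith_cTransform_sub {R : NNReal} (hR : ∀ x ∈ K, ‖x‖ ≤ R) (V : C(K, ℝ)) :
    LipschitzWith R fun x => cTransform V x - 1 / 2 * ‖x‖ ^ 2 := by
  refine LipschitzWith.of_le_add_mul _ fun x x' => ?_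
  rw [dist_eq_norm]
  exact cTransform_sub_le hR V x x'

lemma continuous_cTransform (V : C(K, ℝ)) : Continuous (cTransform (⇑V)) := by
  obtain ⟨R, hR⟩ := exists_norm_bound K
  have h := (lipschitzWith_cTransform_sub hR V).continuous.add
    (by fun_prop : Continuous fun x : EuclideanSpace ℝ (Fin d) => 1 / 2 * ‖x‖ ^ 2)
  exact h.congr fun x => by simp

/-- The `c`-transform as a continuous function on `K`. -/
def conj (V : C(K, ℝ)) : C(K, ℝ) :=
  ⟨fun x => cTransform V x, (continuous_cTransform V).comp continuous_subtype_val⟩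

lemma conj_apply (V : C(K, ℝ)) (x : K) : conj V x = cTransform V x := rfl

lemma conj_add_le (V : C(K, ℝ)) (x y : K) :
    conj V x + V y ≤ cost (x : EuclideanSpace ℝ (Fin d)) y := by
  have := cTransform_le V x y
  rw [conj_apply]; linarith

/-- Maximality of the transform among admissible partners of `V`. Together with `conj_add_le` it
yields the algebra of `conj` below without returning to infima. -/
lemma le_conj {U V : C(K, ℝ)} (h : ∀ x y : K, U x + V y ≤ cost (x : EuclideanSpace ℝ (Fin d)) y)
    (x : K) : U x ≤ conj V x :=
  le_ciInf fun y => by linarith [h x y]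

lemma le_conj_conj (V : C(K, ℝ)) (y : K) : V y ≤ conj (conj V) y :=
  le_conj (fun x y => by rw [add_comm, cost_comm]; exact conj_add_le V y x) y

lemma conj_conj_conj (V : C(K, ℝ)) : conj (conj (conj V)) = conj V := by
  ext x
  refine le_antisymm ?_ (le_conj_conj (conj V) x)
  exact le_conj (fun x y => (add_le_add le_rfl (le_conj_conj V y)).trans
    (conj_add_le (conj (conj V)) x y)) x

lemma conj_add_const (V : C(K, ℝ)) (a : ℝ) :
    conj (V + ContinuousMap.const K a) = conj V - ContinuousMap.const K a := by
  ext x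
  refine le_antisymm ?_ ?_
  · have := le_conj (U := conj (V + ContinuousMap.const K a) + ContinuousMap.const K a) (V := V)
      (fun x y => by
        have := conj_add_le (V + ContinuousMap.const K a) x y
        simp at this ⊢; linarith) x
    simp at this ⊢; linarith
  · exact le_conj (U := conj V - ContinuousMap.const K a) (fun x y => by
      have := conj_add_le V x y
      simp; linarith) x

lemma conj_le_of_le {U V : C(K, ℝ)} {δ : ℝ} (h : ∀ y, V y ≤ U y + δ) (x : K) :
    conj U x ≤ conj V x + δ := by
  have := le_conj (U := conj U - ContinuousMap.const K δ) (V := V) (fun x y => by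
    have := conj_add_le U x y
    have := h y
    simp; linarith) x
  simp at this; linarith

lemma continuous_conj : Continuous (conj : C(K, ℝ) → C(K, ℝ)) := by
  refine (LipschitzWith.mk_one fun U V => ?_).continuous
  rw [ContinuousMap.dist_le dist_nonneg]
  intro x
  have h1 := conj_le_of_le (U := U) (V := V) (δ := dist U V) (fun y => by
    have := (abs_le.1 (ContinuousMap.dist_apply_le_dist (f := U) (g := V) y)).1; linarith) x
  have h2 := conj_le_of_le (U := V) (V := U) (δ := dist U V) (fun y => by
    have := (abs_le.1 (ContinuousMap.dist_apply_le_dist (f := U) (g := V) y)).2; linarith) x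
  rw [Real.dist_eq, abs_le]
  constructor <;> linarith

/-- One `R` comes from the infimum of affine functions, the other from `½|x|²` on the ball of radius
`R`. The constant does not depend on `V`, which gives equicontinuity. -/
lemma lipschitzWith_conj {R : NNReal} (hR : ∀ x ∈ K, ‖x‖ ≤ R) (V : C(K, ℝ)) :
    LipschitzWith (2 * R) (conj V) := by
  refine LipschitzWith.of_le_add_mul _ fun x x' => ?_
  have h := cTransform_sub_le hR V x x'
  have h1 := hR x x.2
  have h2 := hR x' x'.2
  have h3 : ‖(x : EuclideanSpace ℝ (Fin d))‖ - ‖(x' : EuclideanSpace ℝ (Fin d))‖ ≤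
    ‖(x : EuclideanSpace ℝ (Fin d)) - x'‖ := norm_sub_norm_le _ _
  have h4 : 1 / 2 * ‖(x : EuclideanSpace ℝ (Fin d))‖ ^ 2 -
      1 / 2 * ‖(x' : EuclideanSpace ℝ (Fin d))‖ ^ 2 ≤
      R * ‖(x : EuclideanSpace ℝ (Fin d)) - x'‖ := by
    have h5 := norm_nonneg (x : EuclideanSpace ℝ (Fin d))
    have h6 := norm_nonneg (x' : EuclideanSpace ℝ (Fin d))
    have h7 := norm_nonneg ((x : EuclideanSpace ℝ (Fin d)) - x')
    nlinarith [mul_le_mul_of_nonneg_right h3 (add_nonneg h5 h6),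
      mul_le_mul_of_nonneg_left (add_le_add h1 h2) h7]
  rw [conj_apply, conj_apply, Subtype.dist_eq, dist_eq_norm]
  push_cast
  linarith

/-- The semi-dual functional `∫ V^c dμ + ∫ V dν`. -/
def semiDual (μ ν : ProbabilityMeasure K) (V : C(K, ℝ)) : ℝ :=
  ∫ x, conj V x ∂(μ : Measure K) + ∫ y, V y ∂(ν : Measure K)

lemma semiDual_le_objective (μ ν : ProbabilityMeasure K) (V : C(K, ℝ)) {S : K → K}
    (hS : Measurable S) : semiDual μ ν V ≤ objective μ ν V S := by
  refine add_le_add (integral_mono (integrable_continuousMap μ (conj V)) ?_ ?_) le_rfl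
  · exact integrable_comp_prodMk μ hS (f := fun p => cost (p.1 : EuclideanSpace ℝ (Fin d)) p.2 - V p.2)
      (by fun_prop)
  · intro x
    have := conj_add_le V x (S x)
    dsimp only; linarith

/-- Near-minimizers in the `c`-transform can be selected measurably. -/
lemma exists_measurable_near_minimizer (V : C(K, ℝ)) {δ : ℝ} (hδ : 0 < δ) :
    ∃ S : K → K, Measurable S ∧
      ∀ x : K, cost (x : EuclideanSpace ℝ (Fin d)) (S x) - V (S x) ≤ conj V x + δ := by
  classical
  -- Taking the first admissible point of a dense sequence makes the choice countably valued, hence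
  -- measurable.
  set e := TopologicalSpace.denseSeq K
  have hex : ∀ x : K, ∃ n, cost (x : EuclideanSpace ℝ (Fin d)) (e n) - V (e n) < conj V x + δ := by
    intro x
    have hlt : conj V x < conj V x + δ := by linarith
    obtain ⟨y, hy⟩ := exists_lt_of_ciInf_lt (f := fun y : K => cost (x : EuclideanSpace ℝ (Fin d)) y - V y) hlt
    have hopen : IsOpen {y : K | cost (x : EuclideanSpace ℝ (Fin d)) y - V y < conj V x + δ} :=
      isOpen_lt (by fun_prop) (by fun_prop)
    exact (TopologicalSpace.denseRange_denseSeq K).exists_mem_open hopen ⟨y, hy⟩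
  refine ⟨fun x => e (Nat.find (hex x)), ?_, fun x => (Nat.find_spec (hex x)).le⟩
  refine (measurable_from_top (f := e)).comp (measurable_find hex fun n => ?_)
  exact (isOpen_lt (by fun_prop) (by fun_prop)).measurableSet

lemma innerValue_eq (μ ν : ProbabilityMeasure K) (V : C(K, ℝ)) :
    innerValue μ ν V = semiDual μ ν V := by
  have : Nonempty {T : K → K // Measurable T} := ⟨⟨id, measurable_id⟩⟩
  have hb : BddBelow (Set.range fun T : {T : K → K // Measurable T} => objective μ ν V T) :=
    ⟨semiDual μ ν V, by rintro _ ⟨T, rfl⟩; exact semiDual_le_objective μ ν V T.2⟩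
  refine le_antisymm (le_of_forall_pos_le_add fun δ hδ => ?_)
    (le_ciInf fun T => semiDual_le_objective μ ν V T.2)
  obtain ⟨S, hS, hSle⟩ := exists_measurable_near_minimizer V hδ
  refine (ciInf_le hb ⟨S, hS⟩).trans ?_
  have h : ∫ x : K, (cost (x : EuclideanSpace ℝ (Fin d)) (S x) - V (S x)) ∂(μ : Measure K) ≤
      ∫ x, (conj V x + δ) ∂(μ : Measure K) :=
    integral_mono (integrable_comp_prodMk μ hS
      (f := fun p => cost (p.1 : EuclideanSpace ℝ (Fin d)) p.2 - V p.2)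
      (by fun_prop))
      ((integrable_continuousMap μ (conj V)).add (integrable_const δ)) hSle
  rw [integral_add (integrable_continuousMap μ (conj V)) (integrable_const δ)] at h
  simp only [integral_const, probReal_univ, smul_eq_mul, one_mul] at h
  simp only [objective, semiDual]
  linarith

lemma isOptimalPotential_iff (μ ν : ProbabilityMeasure K) (V : C(K, ℝ)) :
    IsOptimalPotential μ ν V ↔ ∀ W, semiDual μ ν W ≤ semiDual μ ν V := by
  simp only [IsOptimalPotential, innerValue_eq]

end Transform

/-! ### Compactness and passage to the limit in the semi-dual problem. -/

section Limit

variable {d : ℕ} {K : Set (EuclideanSpace ℝ (Fin d))} [CompactSpace K]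

/-- Weak convergence handles the fixed limit `g`; replacing `g` by `f k` costs at most `dist (f k)
g`, because each measure has mass one. -/
lemma tendsto_integral_of_tendsto {μs : ℕ → ProbabilityMeasure K} {μ : ProbabilityMeasure K}
    (hμ : Tendsto μs atTop (𝓝 μ)) {f : ℕ → C(K, ℝ)} {g : C(K, ℝ)} (hf : Tendsto f atTop (𝓝 g)) :
    Tendsto (fun k => ∫ x, f k x ∂(μs k : Measure K)) atTop (𝓝 (∫ x, g x ∂(μ : Measure K))) := by
  have h1 : Tendsto (fun k => ∫ x, g x ∂(μs k : Measure K)) atTop (𝓝 (∫ x, g x ∂(μ : Measure K))) :=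
    (ProbabilityMeasure.tendsto_iff_forall_integral_tendsto.1 hμ)
      (BoundedContinuousFunction.mkOfCompact g)
  have h2 : Tendsto (fun k => dist (f k) g) atTop (𝓝 0) := tendsto_iff_dist_tendsto_zero.1 hf
  have h3 : Tendsto (fun k => ∫ x, f k x ∂(μs k : Measure K) - ∫ x, g x ∂(μs k : Measure K))
      atTop (𝓝 0) := by
    refine squeeze_zero_norm (fun k => ?_) h2
    rw [← integral_sub (integrable_continuousMap _ _) (integrable_continuousMap _ _)]
    have := norm_integral_le_of_norm_le_const (μ := (μs k : Measure K)) (f := fun x => f k x - g x)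
      (C := dist (f k) g) (.of_forall fun x => by
        rw [← dist_eq_norm]; exact ContinuousMap.dist_apply_le_dist x)
    simpa using this
  simpa using h3.add h1

variable [Nonempty K]

lemma isLimitingPotential_iff (V : ℝ → C(K, ℝ)) (V₀ : C(K, ℝ)) :
    IsLimitingPotential V V₀ ↔ ∃ (ε : ℕ → ℝ) (a : ℕ → ℝ), Tendsto ε atTop (𝓝[>] 0) ∧
      Tendsto (fun k => conj (conj (V (ε k))) + ContinuousMap.const K (a k)) atTop (𝓝 V₀) ∧
      Tendsto (fun k => conj (V (ε k)) - ContinuousMap.const K (a k)) atTop (𝓝 (conj V₀)) := by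
  simp only [ContinuousMap.tendsto_iff_tendstoUniformly]
  rfl

lemma exists_isLimitingPotential (V : ℝ → C(K, ℝ)) :
    ∃ V₀ : C(K, ℝ), IsLimitingPotential V V₀ := by
  obtain ⟨R, hR⟩ := exists_norm_bound K
  obtain ⟨y₀⟩ := ‹Nonempty K›
  have : Nonempty K := ⟨y₀⟩
  let W : ℕ → C(K, ℝ) := fun k => conj (conj (V (1 / ((k : ℝ) + 1))))
  let f : ℕ → C(K, ℝ) := fun k => W k + ContinuousMap.const K (-(W k y₀))
  let A : Set (BoundedContinuousFunction K ℝ) := {g | LipschitzWith (2 * R) g ∧ g y₀ = 0}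
  have hA : IsCompact (closure A) := by
    refine BoundedContinuousFunction.arzela_ascoli
      -- Vanishing at `y₀` and the common Lipschitz constant bound every member of `A` by this
      -- radius.
      (Metric.closedBall 0 ((2 * R : NNReal) * Metric.diam (Set.univ : Set K)))
      (isCompact_closedBall _ _) A (fun g x hg => ?_) ?_
    · have h1 := hg.1.dist_le_mul x y₀
      rw [hg.2] at h1
      refine h1.trans (mul_le_mul_of_nonneg_left ?_ NNReal.zero_le_coe)
      exact Metric.dist_le_diam_of_mem isCompact_univ.isBounded trivial trivial
    · exact (LipschitzWith.uniformEquicontinuous _ (2 * R) fun g : A => g.2.1).equicontinuous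
  have hfA : ∀ k, BoundedContinuousFunction.mkOfCompact (f k) ∈ closure A := by
    refine fun k => subset_closure ⟨?_, by simp [f]⟩
    have h1 := lipschitzWith_conj hR (conj (V (1 / ((k : ℝ) + 1))))
    refine LipschitzWith.of_dist_le_mul fun x y => ?_
    simpa [f, W] using h1.dist_le_mul x y
  obtain ⟨g, -, φ, hφ, hg⟩ := hA.tendsto_subseq hfA
  have hlim : Tendsto (f ∘ φ) atTop (𝓝 g.toContinuousMap) := by
    rw [ContinuousMap.tendsto_iff_tendstoUniformly]
    exact BoundedContinuousFunction.tendsto_iff_tendstoUniformly.1 hg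
  refine ⟨g.toContinuousMap, (isLimitingPotential_iff V _).2
    ⟨fun k => 1 / ((φ k : ℝ) + 1), fun k => -(W (φ k) y₀), ?_, hlim, ?_⟩⟩
  · refine tendsto_nhdsWithin_iff.2 ⟨tendsto_one_div_add_atTop_nhds_zero_nat.comp hφ.tendsto_atTop,
      .of_forall fun k => ?_⟩
    simp only [Set.mem_Ioi]; positivity
  -- The second convergence is the image of the first under the continuous map `conj`, since `V^ccc
  -- = V^c`.
  · refine (((continuous_conj.tendsto _).comp hlim)).congr fun k => ?_
    simp only [Function.comp, f, W, conj_add_const, conj_conj_conj]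

/-- Here `V ≤ V^cc`, and `a` cancels between two probability measures. The right side is built from
exactly the functions that converge for a limiting potential. -/
lemma semiDual_le_semiDual_conj_conj (μ ν : ProbabilityMeasure K) (V : C(K, ℝ)) (a : ℝ) :
    semiDual μ ν V ≤ ∫ x, (conj V - ContinuousMap.const K a) x ∂(μ : Measure K) +
      ∫ y, (conj (conj V) + ContinuousMap.const K a) y ∂(ν : Measure K) := by
  have h1 : ∫ x, (conj V - ContinuousMap.const K a) x ∂(μ : Measure K) =
      ∫ x, conj V x ∂(μ : Measure K) - a := by
    simp [integral_sub (integrable_continuousMap μ (conj V)) (integrable_const a)]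
  have h2 : ∫ y, (conj (conj V) + ContinuousMap.const K a) y ∂(ν : Measure K) =
      ∫ y, conj (conj V) y ∂(ν : Measure K) + a := by
    simp [integral_add (integrable_continuousMap ν (conj (conj V))) (integrable_const a)]
  have h3 : ∫ y, V y ∂(ν : Measure K) ≤ ∫ y, conj (conj V) y ∂(ν : Measure K) :=
    integral_mono (integrable_continuousMap _ _) (integrable_continuousMap _ _) (le_conj_conj V)
  rw [h1, h2, semiDual]; linarith

lemma IsLimitingPotential.isOptimalPotential {ν μ : ProbabilityMeasure K}
    {με : ℝ → ProbabilityMeasure K} (hlim : Tendsto με (𝓝[>] 0) (𝓝 μ)) {V : ℝ → C(K, ℝ)}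
    (hopt : ∀ ε > 0, IsOptimalPotential (με ε) ν (V ε)) {V₀ : C(K, ℝ)}
    (h : IsLimitingPotential V V₀) : IsOptimalPotential μ ν V₀ := by
  obtain ⟨ε, a, hε, h1, h2⟩ := (isLimitingPotential_iff V V₀).1 h
  refine (isOptimalPotential_iff μ ν V₀).2 fun W => ?_
  have hμ : Tendsto (fun k => με (ε k)) atTop (𝓝 μ) := hlim.comp hε
  refine le_of_tendsto_of_tendsto
    ((tendsto_integral_of_tendsto hμ (tendsto_const_nhds (x := conj W))).add
      (tendsto_const_nhds (x := ∫ y, W y ∂(ν : Measure K))))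
    ((tendsto_integral_of_tendsto hμ h2).add
      (tendsto_integral_of_tendsto (tendsto_const_nhds (x := ν)) h1)) ?_
  filter_upwards [(tendsto_nhdsWithin_iff.1 hε).2] with k hk
  exact ((isOptimalPotential_iff _ _ _).1 (hopt _ hk) W).trans
    (semiDual_le_semiDual_conj_conj _ _ _ _)

end Limit

/-! ### Kantorovich duality by Hahn–Banach and Riesz representation. -/

section Kantorovich

variable {X Y : Type*} [TopologicalSpace X] [CompactSpace X] [MeasurableSpace X]
  [TopologicalSpace Y] [CompactSpace Y] [MeasurableSpace Y]

/-- The smallest value `∫ u dμ + ∫ v dν` of a separable majorant `u ⊕ v` of `f`. -/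
def upperValue (μ : Measure X) (ν : Measure Y) (f : C(X × Y, ℝ)) : ℝ :=
  sInf {r | ∃ (u : C(X, ℝ)) (v : C(Y, ℝ)), (∀ x y, f (x, y) ≤ u x + v y) ∧
    r = ∫ x, u x ∂μ + ∫ y, v y ∂ν}

lemma le_upperValue (μ : Measure X) (ν : Measure Y) {f : C(X × Y, ℝ)} {a : ℝ}
    (h : ∀ (u : C(X, ℝ)) (v : C(Y, ℝ)), (∀ x y, f (x, y) ≤ u x + v y) →
      a ≤ ∫ x, u x ∂μ + ∫ y, v y ∂ν) : a ≤ upperValue μ ν f := by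
  refine le_csInf ⟨_, ContinuousMap.const X ‖f‖, 0, fun x y => ?_, rfl⟩ ?_
  · simpa using le_of_abs_le (f.norm_coe_le_norm (x, y))
  · rintro _ ⟨u, v, huv, rfl⟩
    exact h u v huv

variable [BorelSpace X] [BorelSpace Y]

lemma le_integral_add_integral (μ : Measure X) [IsProbabilityMeasure μ] (ν : Measure Y)
    [IsProbabilityMeasure ν] {u : C(X, ℝ)} {v : C(Y, ℝ)} {a : ℝ} (h : ∀ x y, a ≤ u x + v y) :
    a ≤ ∫ x, u x ∂μ + ∫ y, v y ∂ν := by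
  have h1 : ∀ y, a - v y ≤ ∫ x, u x ∂μ := fun y => by
    have := integral_mono (integrable_const (a - v y)) (integrable_continuousMap μ u)
      (fun x => by linarith [h x y])
    simpa using this
  have h2 := integral_mono (integrable_const (a - ∫ x, u x ∂μ)) (integrable_continuousMap ν v)
      (fun y => by linarith [h1 y])
  simp at h2
  linarith

variable (μ : Measure X) [IsProbabilityMeasure μ] (ν : Measure Y) [IsProbabilityMeasure ν]

lemma upperValue_le {f : C(X × Y, ℝ)} {u : C(X, ℝ)} {v : C(Y, ℝ)}
    (h : ∀ x y, f (x, y) ≤ u x + v y) : upperValue μ ν f ≤ ∫ x, u x ∂μ + ∫ y, v y ∂ν := by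
  refine csInf_le ⟨-‖f‖, ?_⟩ ⟨u, v, h, rfl⟩
  rintro _ ⟨u, v, h, rfl⟩
  exact le_integral_add_integral μ ν fun x y =>
    (neg_le_of_abs_le (f.norm_coe_le_norm (x, y))).trans (h x y)

lemma upperValue_smul_le {c : ℝ} (hc : 0 < c) (f : C(X × Y, ℝ)) :
    upperValue μ ν (c • f) ≤ c * upperValue μ ν f := by
  rw [← div_le_iff₀' hc]
  refine le_upperValue μ ν fun u v h => ?_
  rw [div_le_iff₀' hc]
  refine (upperValue_le μ ν (u := c • u) (v := c • v) fun x y => ?_).trans_eq ?_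
  · have := mul_le_mul_of_nonneg_left (h x y) hc.le
    simp only [ContinuousMap.smul_apply, smul_eq_mul]; linarith
  · simp only [ContinuousMap.smul_apply, smul_eq_mul, integral_const_mul]; ring

lemma upperValue_smul {c : ℝ} (hc : 0 < c) (f : C(X × Y, ℝ)) :
    upperValue μ ν (c • f) = c * upperValue μ ν f := by
  refine le_antisymm (upperValue_smul_le μ ν hc f) ?_
  have := upperValue_smul_le μ ν (inv_pos.2 hc) (c • f)
  rwa [inv_smul_smul₀ hc.ne', ← div_eq_inv_mul, le_div_iff₀' hc] at this

lemma upperValue_add_le (f g : C(X × Y, ℝ)) :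
    upperValue μ ν (f + g) ≤ upperValue μ ν f + upperValue μ ν g := by
  rw [← sub_le_iff_le_add]
  refine le_upperValue μ ν fun u v h => ?_
  rw [sub_le_iff_le_add, ← sub_le_iff_le_add']
  refine le_upperValue μ ν fun u' v' h' => ?_
  rw [sub_le_iff_le_add']
  refine (upperValue_le μ ν (u := u + u') (v := v + v') fun x y => ?_).trans_eq ?_
  · have := h x y
    have := h' x y
    simp only [ContinuousMap.add_apply]; linarith
  · simp only [ContinuousMap.add_apply]
    rw [integral_add (integrable_continuousMap _ _) (integrable_continuousMap _ _),
      integral_add (integrable_continuousMap _ _) (integrable_continuousMap _ _)]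
    ring

/-- Hahn–Banach for the sublinear functional `upperValue`, tight at `f`. With `f = -c`, domination
will force positivity and the marginals, and tightness will give the cost. -/
lemma exists_linearMap_le_upperValue (f : C(X × Y, ℝ)) :
    ∃ l : C(X × Y, ℝ) →ₗ[ℝ] ℝ, l f = upperValue μ ν f ∧ ∀ g, l g ≤ upperValue μ ν g := by
  have h0 : upperValue μ ν (0 : C(X × Y, ℝ)) = 0 := by
    have := upperValue_smul μ ν (two_pos : (0 : ℝ) < 2) (0 : C(X × Y, ℝ))
    rw [smul_zero] at this; linarith
  have H : ∀ c : ℝ, c • f = 0 → RingHom.id ℝ c • upperValue μ ν f = 0 := by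
    intro c hc
    rcases smul_eq_zero.1 hc with rfl | rfl
    · simp
    · simp [h0]
  obtain ⟨l, hl, hle⟩ := exists_extension_of_le_sublinear
    (LinearPMap.mkSpanSingleton' f (upperValue μ ν f) H) (upperValue μ ν)
    (fun c hc g => upperValue_smul μ ν hc g) (upperValue_add_le μ ν) (by
      rintro ⟨g, hg⟩
      obtain ⟨c, rfl⟩ := Submodule.mem_span_singleton.1 hg
      rw [LinearPMap.mkSpanSingleton'_apply]
      simp only [RingHom.id_apply, smul_eq_mul]
      rcases lt_trichotomy c 0 with hc | rfl | hc
      -- For negative `c`, subadditivity at `c • f + (-c) • f = 0` gives the required bound.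
      · have h1 := upperValue_smul μ ν (neg_pos.2 hc) f
        have h2 := upperValue_add_le μ ν (c • f) (-c • f)
        rw [← add_smul, add_neg_cancel, zero_smul, h0] at h2
        linarith
      · simp [h0]
      · exact (upperValue_smul μ ν hc f).ge)
  refine ⟨l, ?_, hle⟩
  exact (hl ⟨f, Submodule.mem_span_singleton_self f⟩).trans
    (LinearPMap.mkSpanSingleton'_apply_self _ _ H _)

variable [T2Space X] [T2Space Y] [SecondCountableTopology Y]

/-- A positive linear functional on the continuous functions of a compact space is an integral. -/
lemma exists_measure_integral_eq {Z : Type*} [TopologicalSpace Z] [T2Space Z] [CompactSpace Z]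
    [MeasurableSpace Z] [BorelSpace Z] (l : C(Z, ℝ) →ₗ[ℝ] ℝ) (hl : ∀ f : C(Z, ℝ), 0 ≤ f → 0 ≤ l f) :
    ∃ π : Measure Z, IsFiniteMeasure π ∧ ∀ f : C(Z, ℝ), ∫ z, f z ∂π = l f := by
  let Λ : CompactlySupportedContinuousMap Z ℝ →ₚ[ℝ] ℝ :=
    { toFun g := l g.toContinuousMap
      map_add' g g' := l.map_add g.toContinuousMap g'.toContinuousMap
      map_smul' c g := l.map_smul c g.toContinuousMap
      monotone' g g' h := by
        have := hl (g'.toContinuousMap - g.toContinuousMap) (fun z => sub_nonneg.2 (h z))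
        rw [map_sub] at this
        exact sub_nonneg.1 this }
  refine ⟨RealRMK.rieszMeasure Λ, inferInstance, fun f => ?_⟩
  exact RealRMK.integral_rieszMeasure Λ ⟨f, HasCompactSupport.of_compactSpace _⟩

/-- **Kantorovich duality** on compact spaces: if `J` bounds all admissible dual values, there is
a transport plan of cost at most `J`. -/
theorem exists_transportPlan_integral_le [HasOuterApproxClosed X] [HasOuterApproxClosed Y]
    (c : C(X × Y, ℝ)) {J : ℝ}
    (hJ : ∀ (u : C(X, ℝ)) (v : C(Y, ℝ)), (∀ x y, u x + v y ≤ c (x, y)) →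
      ∫ x, u x ∂μ + ∫ y, v y ∂ν ≤ J) :
    ∃ π : Measure (X × Y), IsProbabilityMeasure π ∧ π.map Prod.fst = μ ∧ π.map Prod.snd = ν ∧
      ∫ p, c p ∂π ≤ J := by
  obtain ⟨l, hl, hle⟩ := exists_linearMap_le_upperValue μ ν (-c)
  -- On separable functions the bounds on `l f` and `l (-f)` coincide, so `l` is determined there;
  -- this fixes both marginals.
  have hsep : ∀ (f : C(X × Y, ℝ)) (u : C(X, ℝ)) (v : C(Y, ℝ)), (∀ x y, f (x, y) = u x + v y) →
      l f = ∫ x, u x ∂μ + ∫ y, v y ∂ν := by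
    intro f u v h
    refine le_antisymm ((hle f).trans (upperValue_le μ ν fun x y => (h x y).le)) ?_
    have := (hle (-f)).trans (upperValue_le μ ν (u := -u) (v := -v) fun x y => by
      simp [h x y, add_comm])
    simp only [map_neg, ContinuousMap.neg_apply, integral_neg] at this
    linarith
  obtain ⟨π, hfin, hπ⟩ := exists_measure_integral_eq l (fun f hf => by
    have := (hle (-f)).trans (upperValue_le μ ν (u := 0) (v := 0) fun x y => by
      simpa using hf (x, y))
    simpa using this)
  have h1 : π.map Prod.fst = μ := by
    refine ext_of_forall_integral_eq_of_IsFiniteMeasure fun f => ?_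
    rw [integral_map measurable_fst.aemeasurable f.continuous.aestronglyMeasurable]
    have := (hπ (f.toContinuousMap.comp ContinuousMap.fst)).trans
      (hsep _ f.toContinuousMap 0 fun x y => by simp)
    simpa using this
  have h2 : π.map Prod.snd = ν := by
    refine ext_of_forall_integral_eq_of_IsFiniteMeasure fun f => ?_
    rw [integral_map measurable_snd.aemeasurable f.continuous.aestronglyMeasurable]
    have := (hπ (f.toContinuousMap.comp ContinuousMap.snd)).trans
      (hsep _ 0 f.toContinuousMap fun x y => by simp)
    simpa using this
  refine ⟨π, ⟨?_⟩, h1, h2, ?_⟩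
  · rw [← Set.preimage_univ (f := Prod.fst), ← Measure.map_apply measurable_fst .univ, h1,
      measure_univ]
  · rw [hπ]
    -- A separable majorant of `-c` is the negative of an admissible dual pair, whose value is at
    -- most `J`.
    have := le_upperValue μ ν (f := -c) (a := -J) fun u v h => by
      have := hJ (-u) (-v) fun x y => by
        have := h x y
        simp at this ⊢; linarith
      simp only [ContinuousMap.neg_apply, integral_neg] at this
      linarith
    rw [← hl, map_neg] at this
    linarith

end Kantorovich

/-! ### Pushing atomless measures forward to arbitrary ones. -/

section Atomless

open ProbabilityTheory unitInterval

lemma continuous_cdf (μ : Measure ℝ) [IsProbabilityMeasure μ] [NullSingletonClass μ] :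
    Continuous (cdf μ) := by
  refine continuous_iff_continuousAt.2 fun a => ?_
  rw [(cdf μ).mono.continuousAt_iff_leftLim_eq_rightLim, StieltjesFunction.rightLim_eq]
  refine le_antisymm ((cdf μ).mono.leftLim_le le_rfl) ?_
  have h := (cdf μ).measure_singleton a
  rw [measure_cdf, measure_singleton] at h
  exact sub_nonpos.1 (ENNReal.ofReal_eq_zero.1 h.symm)

/-- The law of `cdf μ` under `μ` is uniform: for `0 < t < 1` the sublevel set is a closed half-line,
and continuity makes the cdf equal to `t` at its endpoint. -/
lemma measure_cdf_le (μ : Measure ℝ) [IsProbabilityMeasure μ] [NullSingletonClass μ] (t : I) :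
    μ {x | cdf μ x ≤ t} = ENNReal.ofReal t := by
  rcases t.2.2.eq_or_lt with ht | ht
  · rw [ht]; simp [cdf_le_one]
  set S := {x | cdf μ x ≤ t}
  have hclosed : IsClosed S := isClosed_le (continuous_cdf μ) continuous_const
  have hbdd : BddAbove S := by
    obtain ⟨b, hb⟩ := ((tendsto_cdf_atTop μ).eventually (lt_mem_nhds ht)).exists
    exact ⟨b, fun x hx => le_of_lt ((monotone_cdf μ).reflect_lt (lt_of_le_of_lt hx hb))⟩
  rcases S.eq_empty_or_nonempty with hS | hS
  · have : (t : ℝ) ≤ 0 := by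
      by_contra! h
      obtain ⟨b, hb⟩ := ((tendsto_cdf_atBot μ).eventually (gt_mem_nhds h)).exists
      exact Set.notMem_empty b (hS ▸ (show b ∈ S from le_of_lt hb))
    rw [hS, measure_empty, ENNReal.ofReal_of_nonpos this]
  · have hmem : sSup S ∈ S := hclosed.csSup_mem hS hbdd
    have hSeq : S = Set.Iic (sSup S) := by
      ext x
      exact ⟨fun hx => le_csSup hbdd hx, fun hx => (monotone_cdf μ hx).trans hmem⟩
    have hge : (t : ℝ) ≤ cdf μ (sSup S) := by
      refine ge_of_tendsto ((continuous_cdf μ).continuousWithinAt (s := Set.Ioi (sSup S))) ?_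
      filter_upwards [self_mem_nhdsWithin] with y hy
      by_contra! h
      exact absurd (le_csSup hbdd (show y ∈ S from h.le)) (not_le.2 hy)
    rw [hSeq, ← ofReal_cdf, le_antisymm hmem hge]

variable {X Y : Type*} [MeasurableSpace X] [StandardBorelSpace X] [MeasurableSpace Y]
  [StandardBorelSpace Y] [Nonempty Y]

/-- An atomless probability measure can be pushed forward to the uniform measure on `[0, 1]`. -/
lemma exists_measurable_map_eq_volume (μ : Measure X) [IsProbabilityMeasure μ]
    [NullSingletonClass μ] : ∃ f : X → I, Measurable f ∧ μ.map f = volume := by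
  have hg := measurableEmbedding_embeddingReal X
  set μ' := μ.map (embeddingReal X)
  have : IsProbabilityMeasure μ' := Measure.isProbabilityMeasure_map hg.measurable.aemeasurable
  have : NullSingletonClass μ' := ⟨fun a => by
    rw [hg.map_apply]
    exact (Set.subsingleton_singleton.preimage hg.injective).measure_zero μ⟩
  let F : ℝ → I := fun x => ⟨cdf μ' x, cdf_nonneg μ' x, cdf_le_one μ' x⟩
  have hF : Measurable F := (monotone_cdf μ').measurable.subtype_mk
  refine ⟨F ∘ embeddingReal X, hF.comp hg.measurable, ?_⟩
  rw [← Measure.map_map hF hg.measurable]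
  have : IsProbabilityMeasure (μ'.map F) := Measure.isProbabilityMeasure_map hF.aemeasurable
  refine Measure.ext_of_Iic _ _ fun t => ?_
  rw [Measure.map_apply hF measurableSet_Iic, unitInterval.volume_Iic]
  exact measure_cdf_le μ' t

/-- An atomless probability measure can be pushed forward to any probability measure. -/
lemma exists_measurable_map_eq_of_isProbabilityMeasure (μ : Measure X) [IsProbabilityMeasure μ]
    [NullSingletonClass μ] (ν : Measure Y) [IsProbabilityMeasure ν] :
    ∃ f : X → Y, Measurable f ∧ μ.map f = ν := by
  obtain ⟨f, hf, hfμ⟩ := exists_measurable_map_eq_volume μ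
  obtain ⟨g, hg, hgν⟩ := ν.exists_measurable_map_eq
  exact ⟨g ∘ f, hg.comp hf, by rw [← Measure.map_map hg hf, hfμ, hgν]⟩

/-- An atomless finite measure can be pushed forward to any measure of the same total mass. -/
lemma exists_measurable_map_eq_of_measure_univ_eq (μ : Measure X) [IsFiniteMeasure μ]
    [NullSingletonClass μ] (ν : Measure Y) (h : μ Set.univ = ν Set.univ) :
    ∃ f : X → Y, Measurable f ∧ μ.map f = ν := by
  have hfin : IsFiniteMeasure ν := ⟨h ▸ measure_lt_top μ _⟩
  rcases eq_zero_or_neZero μ with rfl | hμ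
  · obtain ⟨y⟩ := ‹Nonempty Y›
    refine ⟨fun _ => y, measurable_const, ?_⟩
    rw [Measure.map_zero, eq_comm, ← Measure.measure_univ_eq_zero, ← h, Measure.coe_zero,
      Pi.zero_apply]
  · have hν : NeZero ν := ⟨fun h0 => hμ.out (Measure.measure_univ_eq_zero.1 (by rw [h, h0]; simp))⟩
    have : NullSingletonClass ((μ Set.univ)⁻¹ • μ) := ⟨fun x => by simp⟩
    obtain ⟨f, hf, hfν⟩ := exists_measurable_map_eq_of_isProbabilityMeasure
      ((μ Set.univ)⁻¹ • μ) ((ν Set.univ)⁻¹ • ν)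
    refine ⟨f, hf, ?_⟩
    have h1 := congrArg (fun m => μ Set.univ • m) hfν
    have hne : μ Set.univ ≠ 0 := (NeZero.ne _)
    simpa only [Measure.map_smul, smul_smul, ← h,
      ENNReal.mul_inv_cancel hne (measure_ne_top μ _), one_smul] using h1

end Atomless

/-! ### Approximation of plans by maps. -/

section MongeApproximation

lemma measure_eq_tsum_preimage_singleton {X : Type*} [MeasurableSpace X] (μ : Measure X)
    {f : X → ℕ} (hf : Measurable f) {B : Set X} (hB : MeasurableSet B) :
    μ B = ∑' n, μ (B ∩ f ⁻¹' {n}) := by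
  rw [← measure_iUnion (fun i j hij => ?_) fun n => hB.inter (hf (measurableSet_singleton n)),
    ← Set.inter_iUnion, ← Set.preimage_iUnion, Set.iUnion_singleton_eq_range, Set.range_id',
    Set.preimage_univ, Set.inter_univ]
  exact Set.disjoint_left.2 fun x h1 h2 => hij (h1.2.symm.trans h2.2)

/-- A plan with an atomless first marginal is the law of a map that moves the first coordinate
only inside the cells of a given countable partition. -/
lemma exists_measurable_map_eq_of_partition {X Y : Type*} [MeasurableSpace X]
    [StandardBorelSpace X] [Nonempty X] [MeasurableSpace Y] [StandardBorelSpace Y] [Nonempty Y]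
    (μ : Measure X) [IsFiniteMeasure μ] [NullSingletonClass μ] (π : Measure (X × Y))
    (hπ : π.map Prod.fst = μ) {f : X → ℕ} (hf : Measurable f) :
    ∃ Q : X → X × Y, Measurable Q ∧ μ.map Q = π ∧ ∀ᵐ x ∂μ, f (Q x).1 = f x := by
  have hcell : ∀ n, MeasurableSet (f ⁻¹' {n}) := fun n => hf (measurableSet_singleton n)
  -- The cell and the strip above it have equal mass because `μ` is the first marginal; the maps `q
  -- n` are then glued cell by cell.
  have hex : ∀ n, ∃ q : X → X × Y, Measurable q ∧
      (μ.restrict (f ⁻¹' {n})).map q = π.restrict (Prod.fst ⁻¹' (f ⁻¹' {n})) := fun n =>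
    exists_measurable_map_eq_of_measure_univ_eq _ _ (by
      rw [Measure.restrict_apply_univ, Measure.restrict_apply_univ, ← hπ,
        Measure.map_apply measurable_fst (hcell n)])
  choose q hq hqπ using hex
  have hQ : Measurable fun x => q (f x) x :=
    (measurable_from_prod_countable_left (f := fun p : X × ℕ => q p.2 p.1) hq).comp
      (measurable_id.prodMk hf)
  have hcellQ : ∀ n B, MeasurableSet B → μ ((fun x => q (f x) x) ⁻¹' B ∩ f ⁻¹' {n}) =
      π (B ∩ (fun p => f p.1) ⁻¹' {n}) := by
    intro n B hB
    have h := congrArg (fun m => m B) (hqπ n)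
    simp only [Measure.map_apply (hq n) hB, Measure.restrict_apply (hq n hB),
      Measure.restrict_apply hB] at h
    refine Eq.trans (congrArg μ ?_) h
    ext x
    simp only [Set.mem_inter_iff, Set.mem_preimage, Set.mem_singleton_iff]
    constructor <;> rintro ⟨h1, rfl⟩ <;> exact ⟨h1, rfl⟩
  have hf1 : Measurable fun p : X × Y => f p.1 := hf.comp measurable_fst
  refine ⟨_, hQ, ?_, ?_⟩
  · ext B hB
    rw [Measure.map_apply hQ hB, measure_eq_tsum_preimage_singleton μ hf (hQ hB),
      measure_eq_tsum_preimage_singleton π hf1 hB]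
    exact tsum_congr fun n => hcellQ n B hB
  · have hmeas : MeasurableSet {x | f (q (f x) x).1 = f x} :=
      measurableSet_eq_fun (hf1.comp hQ) hf
    change μ {x | f (q (f x) x).1 = f x}ᶜ = 0
    rw [measure_eq_tsum_preimage_singleton μ hf hmeas.compl]
    refine ENNReal.tsum_eq_zero.2 fun n => ?_
    have h := hcellQ n ((fun p => f p.1) ⁻¹' {n})ᶜ (hf1 (measurableSet_singleton n)).compl
    rw [Set.compl_inter_self, measure_empty] at h
    refine measure_mono_null ?_ h
    rintro x ⟨h1, rfl⟩
    exact ⟨h1, rfl⟩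

/-- For an atomless source the cost of a plan can be approximated by that of transport maps. -/
theorem exists_map_integral_le_add {X : Type*} [MetricSpace X] [CompactSpace X]
    [MeasurableSpace X] [BorelSpace X] (μ : Measure X) [IsProbabilityMeasure μ]
    [NullSingletonClass μ] (π : Measure (X × X)) [IsProbabilityMeasure π]
    (hπ : π.map Prod.fst = μ) (c : C(X × X, ℝ)) {δ : ℝ} (hδ : 0 < δ) :
    ∃ S : X → X, Measurable S ∧ μ.map S = π.map Prod.snd ∧
      ∫ x, c (x, S x) ∂μ ≤ ∫ p, c p ∂π + δ := by
  classical
  have : Nonempty X := nonempty_of_isProbabilityMeasure μ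
  obtain ⟨η, hη, hc⟩ := Metric.uniformContinuous_iff.1
    (CompactSpace.uniformContinuous_of_continuous c.continuous) δ hδ
  have hex : ∀ x, ∃ n, dist x (TopologicalSpace.denseSeq X n) < η / 2 := fun x =>
    (TopologicalSpace.denseRange_denseSeq X).exists_dist_lt x (half_pos hη)
  -- Points in the same cell are within `η` of each other, so replacing `(Q x).1` by `x` changes the
  -- cost by less than `δ`.
  let f : X → ℕ := fun x => Nat.find (hex x)
  have hf : Measurable f := measurable_find hex fun n =>
    (isOpen_lt (by fun_prop) (by fun_prop)).measurableSet
  obtain ⟨Q, hQ, hQπ, hQf⟩ := exists_measurable_map_eq_of_partition μ π hπ hf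
  have hSm : Measurable fun x => (Q x).2 := measurable_snd.comp hQ
  refine ⟨_, hSm, ?_, ?_⟩
  · rw [← hQπ, Measure.map_map measurable_snd hQ]; rfl
  · have h1 : ∫ p, c p ∂π = ∫ x, c (Q x) ∂μ := by
      rw [← hQπ, integral_map hQ.aemeasurable c.continuous.aestronglyMeasurable]
    have hint : ∀ g : X → X × X, Measurable g → Integrable (fun x => c (g x)) μ := fun g hg =>
      Integrable.of_bound (C := ‖c‖) (c.continuous.measurable.comp hg).aestronglyMeasurable
        (.of_forall fun x => c.norm_coe_le_norm _)
    have h2 : ∫ x, c (x, (Q x).2) ∂μ ≤ ∫ x, (c (Q x) + δ) ∂μ := by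
      refine integral_mono_ae (hint _ (measurable_id.prodMk hSm))
        ((hint Q hQ).add (integrable_const δ)) ?_
      filter_upwards [hQf] with x hx
      have h3 := Nat.find_spec (hex x)
      have h4 := Nat.find_spec (hex (Q x).1)
      change dist x (TopologicalSpace.denseSeq X (f x)) < η / 2 at h3
      change dist (Q x).1 (TopologicalSpace.denseSeq X (f (Q x).1)) < η / 2 at h4
      rw [hx] at h4
      have h5 : dist (x, (Q x).2) (Q x) < η := by
        rw [Prod.dist_eq]
        refine max_lt ?_ (by simpa using hη)
        exact (dist_triangle_right _ _ _).trans_lt (by linarith)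
      have h6 := hc h5
      rw [Real.dist_eq] at h6
      linarith [(abs_lt.1 h6).2]
    rw [integral_add (hint Q hQ) (integrable_const δ), ← h1] at h2
    simpa using h2

end MongeApproximation

/-! ### Absence of a duality gap and complementary slackness. -/

section Duality

variable {d : ℕ} {K : Set (EuclideanSpace ℝ (Fin d))} [CompactSpace K] [Nonempty K]

/-- For an atomless source, a semi-dual optimizer and an optimal map satisfy the complementary
slackness relation. -/
theorem ae_conj_add_eq_cost {μ ν : ProbabilityMeasure K} [NullSingletonClass (μ : Measure K)]
    {V : C(K, ℝ)} (hV : IsOptimalPotential μ ν V) {T : K → K} (hT : IsOptimalMap μ ν T) :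
    ∀ᵐ x : K ∂(μ : Measure K),
      conj V x + V (T x) = cost (x : EuclideanSpace ℝ (Fin d)) (T x) := by
  let c : C(K × K, ℝ) := ⟨fun p => cost (p.1 : EuclideanSpace ℝ (Fin d)) p.2, by fun_prop⟩
  obtain ⟨π, hπ, hπ1, hπ2, hπJ⟩ := exists_transportPlan_integral_le (μ : Measure K) (ν : Measure K)
    c (J := semiDual μ ν V) (fun u v huv => by
      refine le_trans ?_ ((isOptimalPotential_iff μ ν V).1 hV v)
      exact add_le_add (integral_mono (integrable_continuousMap _ _) (integrable_continuousMap _ _)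
        (le_conj huv)) le_rfl)
  have hcost : ∫ x, c (x, T x) ∂(μ : Measure K) ≤ semiDual μ ν V := by
    refine le_of_forall_pos_le_add fun δ hδ => ?_
    obtain ⟨S, hS, hSν, hSc⟩ := exists_map_integral_le_add (μ : Measure K) π hπ1 c hδ
    exact (hT.cost_le S hS (hSν.trans hπ2)).trans (hSc.trans (by linarith))
  have hν : ∫ y, V y ∂(ν : Measure K) = ∫ x, V (T x) ∂(μ : Measure K) := by
    rw [← hT.map_eq, integral_map hT.measurable.aemeasurable V.continuous.aestronglyMeasurable]
  have hi1 : Integrable (fun x => c (x, T x)) (μ : Measure K) :=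
    integrable_comp_prodMk μ hT.measurable c.continuous
  have hi2 : Integrable (fun x => conj V x + V (T x)) (μ : Measure K) :=
    (integrable_continuousMap μ (conj V)).add
      (integrable_comp_prodMk μ hT.measurable (f := fun p => V p.2) (by fun_prop))
  have hi3 : Integrable (fun x => V (T x)) (μ : Measure K) :=
    integrable_comp_prodMk μ hT.measurable (f := fun p => V p.2) (by fun_prop)
  have hnn : ∀ x, 0 ≤ c (x, T x) - (conj V x + V (T x)) := fun x =>
    sub_nonneg.2 (conj_add_le V x (T x))
  -- The slack is nonnegative pointwise and, by `hcost`, has integral zero.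
  have hzero : ∫ x, (c (x, T x) - (conj V x + V (T x))) ∂(μ : Measure K) = 0 := by
    refine le_antisymm ?_ (integral_nonneg hnn)
    rw [integral_sub hi1 hi2, integral_add (integrable_continuousMap μ (conj V)) hi3, ← hν]
    exact sub_nonpos.2 hcost
  filter_upwards [(integral_eq_zero_iff_of_nonneg hnn (hi1.sub hi2)).1 hzero] with x hx
  exact (sub_eq_zero.1 hx).symm

end Duality

/-! ### Differentiability and tangential gradients on submanifolds. -/

section Submanifold

variable {d m : ℕ} {M : Set (EuclideanSpace ℝ (Fin d))} {x g v : EuclideanSpace ℝ (Fin d)}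

/-- A local parametrization `ψ` of `M` near `x` over a linear space, with a smooth left inverse
`q` that is defined on the ambient space. -/
structure IsLocalParametrization (M : Set (EuclideanSpace ℝ (Fin d)))
    (L : Submodule ℝ (EuclideanSpace ℝ (Fin d))) (ψ : L → EuclideanSpace ℝ (Fin d))
    (q : EuclideanSpace ℝ (Fin d) → L) (x : EuclideanSpace ℝ (Fin d)) : Prop where
  contDiffAt_param : ContDiffAt ℝ ∞ ψ (q x)
  contDiffAt_inverse : ContDiffAt ℝ ∞ q x
  param_inverse : ∀ᶠ y in 𝓝[M] x, ψ (q y) = y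
  param_inverse_self : ψ (q x) = x
  param_mem : ∀ᶠ w in 𝓝 (q x), ψ w ∈ M

/-- Projecting `Φ` onto `L` changes nothing on `M` and makes `q` an `L`-valued smooth map on an
ambient neighbourhood. The same `ψ` and `q` serve all points of `M ∩ U`, as the almost-everywhere
argument needs. -/
lemma IsSmoothSubmanifold.exists_isLocalParametrization (hM : IsSmoothSubmanifold m M)
    (hx : x ∈ M) : ∃ (L : Submodule ℝ (EuclideanSpace ℝ (Fin d)))
      (ψ : L → EuclideanSpace ℝ (Fin d)) (q : EuclideanSpace ℝ (Fin d) → L)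
      (U : Set (EuclideanSpace ℝ (Fin d))), Module.finrank ℝ L = m ∧ IsOpen U ∧ x ∈ U ∧
        ∀ y ∈ U, y ∈ M → IsLocalParametrization M L ψ q y := by
  obtain ⟨Φ, L, hxs, hΦ, hΦs, hL, hΦM⟩ := hM x hx
  have hq : ∀ y ∈ Φ.source, y ∈ M → ((L.orthogonalProjectionOnto (Φ y) : L) :
      EuclideanSpace ℝ (Fin d)) = Φ y := fun y hy hyM => by
    rw [← Submodule.starProjection_apply]
    exact Submodule.starProjection_eq_self_iff.2 ((hΦM y hy).1 hyM)
  have hinv : ∀ y ∈ Φ.source, y ∈ M →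
      Φ.symm ((L.orthogonalProjectionOnto (Φ y) : L) : EuclideanSpace ℝ (Fin d)) = y :=
    fun y hy hyM => by rw [hq y hy hyM, Φ.left_inv hy]
  refine ⟨L, fun w => Φ.symm w, fun y => L.orthogonalProjectionOnto (Φ y), Φ.source, hL,
    Φ.open_source, hxs, fun y hy hyM => ⟨?_, ?_, ?_, hinv y hy hyM, ?_⟩⟩
  · refine ContDiffAt.comp _ ?_ L.subtypeL.contDiff.contDiffAt
    change ContDiffAt ℝ ∞ Φ.symm (L.orthogonalProjectionOnto (Φ y) : EuclideanSpace ℝ (Fin d))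
    rw [hq y hy hyM]
    exact hΦs.contDiffAt (Φ.open_target.mem_nhds (Φ.map_source hy))
  · exact (L.orthogonalProjectionOnto.contDiff.contDiffAt).comp _
      (hΦ.contDiffAt (Φ.open_source.mem_nhds hy))
  · filter_upwards [self_mem_nhdsWithin, mem_nhdsWithin_of_mem_nhds (Φ.open_source.mem_nhds hy)]
      with z hzM hz using hinv z hz hzM
  · have hopen : IsOpen {w : L | (w : EuclideanSpace ℝ (Fin d)) ∈ Φ.target} :=
      Φ.open_target.preimage continuous_subtype_val
    filter_upwards [hopen.mem_nhds (show L.orthogonalProjectionOnto (Φ y) ∈ _ by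
      simp only [Set.mem_ofPred_eq, hq y hy hyM]; exact Φ.map_source hy)] with w hw
    refine (hΦM _ (Φ.map_target hw)).2 ?_
    rw [Φ.right_inv hw]
    exact w.2

/-- **Rademacher's theorem on a submanifold**: the restriction of a Lipschitz function to an
`m`-dimensional submanifold is differentiable `ℋᵐ`-almost everywhere. -/
theorem IsSmoothSubmanifold.hausdorffMeasure_not_differentiableWithinAt
    (hM : IsSmoothSubmanifold m M) {C : NNReal} {φ : EuclideanSpace ℝ (Fin d) → ℝ}
    (hφ : LipschitzWith C φ) :
    Measure.hausdorffMeasure (m : ℝ) {y | y ∈ M ∧ ¬ DifferentiableWithinAt ℝ φ M y} = 0 := by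
  refine measure_null_of_locally_null _ fun x hx => ?_
  obtain ⟨L, ψ, q, U, hL, hU, hxU, hchart⟩ := hM.exists_isLocalParametrization hx.1
  have hx' := hchart x hxU hx.1
  obtain ⟨C', t, ht, hψ⟩ := (hx'.contDiffAt_param.hasStrictFDerivAt (by simp)).exists_lipschitzOnWith
  obtain ⟨t', ht't, ht'o, hqx⟩ := mem_nhds_iff.1 ht
  have hψ' := hψ.mono ht't
  -- Rademacher in `L` makes `N` null, and the Lipschitz map `ψ` keeps it so. Bad points of `M` near
  -- `x` lie in `ψ '' N`, because `φ = (φ ∘ ψ) ∘ q` along `M`.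
  set N := {w | ¬ (w ∈ t' → DifferentiableWithinAt ℝ (φ ∘ ψ) t' w)}
  have hN : Measure.hausdorffMeasure (Module.finrank ℝ L : ℝ) N = 0 :=
    (hφ.comp_lipschitzOnWith hψ').ae_differentiableWithinAt_of_mem
  have hNt : N ⊆ t' := fun w hw => (Classical.not_imp.1 hw).1
  have hψN : Measure.hausdorffMeasure (m : ℝ) (ψ '' N) = 0 := by
    have := (hψ'.mono hNt).hausdorffMeasure_image_le (d := m) (Nat.cast_nonneg m)
    rw [← hL, hN, mul_zero] at this
    rw [← hL]
    exact le_antisymm this zero_le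
  refine ⟨{y | y ∈ M ∧ ¬ DifferentiableWithinAt ℝ φ M y} ∩ (U ∩ q ⁻¹' t'), ?_, ?_⟩
  · exact inter_mem self_mem_nhdsWithin (mem_nhdsWithin_of_mem_nhds (inter_mem (hU.mem_nhds hxU)
      (hx'.contDiffAt_inverse.continuousAt.preimage_mem_nhds (ht'o.mem_nhds hqx))))
  · refine measure_mono_null ?_ hψN
    rintro y ⟨⟨hyM, hy⟩, hyU, hyt⟩
    have hy' := hchart y hyU hyM
    refine ⟨q y, fun hdiff => hy ?_, hy'.param_inverse_self⟩
    have h1 : DifferentiableAt ℝ (φ ∘ ψ) (q y) :=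
      (hdiff hyt).differentiableAt (ht'o.mem_nhds hyt)
    have h2 : DifferentiableAt ℝ ((φ ∘ ψ) ∘ q) y :=
      h1.comp y (hy'.contDiffAt_inverse.differentiableAt (by simp))
    refine h2.differentiableWithinAt.congr_of_eventuallyEq ?_ ?_
    · filter_upwards [hy'.param_inverse] with z hz
      simp only [Function.comp, hz]
    · simp only [Function.comp, hy'.param_inverse_self]

variable {L : Submodule ℝ (EuclideanSpace ℝ (Fin d))} {ψ : L → EuclideanSpace ℝ (Fin d)}
  {q : EuclideanSpace ℝ (Fin d) → L}

lemma IsLocalParametrization.exists_curve (h : IsLocalParametrization M L ψ q x) (w : L) :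
    ∃ γ : ℝ → EuclideanSpace ℝ (Fin d), ContDiffAt ℝ ∞ γ 0 ∧ γ 0 = x ∧
      (∀ᶠ t in 𝓝 (0 : ℝ), γ t ∈ M) ∧ HasDerivAt γ (fderiv ℝ ψ (q x) w) 0 := by
  have hline : ContDiff ℝ ∞ fun t : ℝ => q x + t • w := by fun_prop
  have hl0 : q x + (0 : ℝ) • w = q x := by simp
  have hψ : ContDiffAt ℝ ∞ ψ (q x + (0 : ℝ) • w) := by rw [hl0]; exact h.contDiffAt_param
  refine ⟨fun t => ψ (q x + t • w), ContDiffAt.comp (0 : ℝ) hψ hline.contDiffAt, by simp [h.param_inverse_self],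
    ?_, ?_⟩
  · have : Tendsto (fun t : ℝ => q x + t • w) (𝓝 0) (𝓝 (q x)) := by
      simpa using hline.continuous.tendsto 0
    exact this.eventually h.param_mem
  · have h1 : HasDerivAt (fun t : ℝ => q x + t • w) w 0 := by
      simpa using ((hasDerivAt_id (0 : ℝ)).smul_const w).const_add (q x)
    have h2 : HasFDerivAt ψ (fderiv ℝ ψ (q x)) (q x + (0 : ℝ) • w) := by
      rw [hl0]; exact (h.contDiffAt_param.differentiableAt (by simp)).hasFDerivAt
    exact h2.comp_hasDerivAt 0 h1

lemma IsLocalParametrization.fderiv_mem_tangentSpaceAt (h : IsLocalParametrization M L ψ q x)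
    (w : L) : fderiv ℝ ψ (q x) w ∈ tangentSpaceAt M x := by
  obtain ⟨γ, h1, h2, h3, h4⟩ := h.exists_curve w
  exact Submodule.subset_span ⟨γ, h1, h2, h3, h4.deriv⟩

/-- A function on `M` whose differential agrees with `⟨g, ·⟩` on the tangent directions has
tangential gradient the projection of `g`. -/
lemma IsLocalParametrization.hasTangentialGradientAt (h : IsLocalParametrization M L ψ q x)
    {φ : EuclideanSpace ℝ (Fin d) → ℝ} {φ' : EuclideanSpace ℝ (Fin d) →L[ℝ] ℝ}
    (hφ : HasFDerivWithinAt φ φ' M x)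
    (heq : ∀ w : L, φ' (fderiv ℝ ψ (q x) w) = inner ℝ g (fderiv ℝ ψ (q x) w)) :
    HasTangentialGradientAt M φ ((tangentSpaceAt M x).starProjection g) x := by
  refine ⟨Submodule.starProjection_apply_mem _ _, ?_⟩
  rw [hasGradientWithinAt_iff_hasFDerivWithinAt]
  set G := InnerProductSpace.toDual ℝ (EuclideanSpace ℝ (Fin d))
    ((tangentSpaceAt M x).starProjection g)
  set A : EuclideanSpace ℝ (Fin d) →L[ℝ] ℝ := G - φ'
  have hA : ∀ w : L, A (fderiv ℝ ψ (q x) w) = 0 := fun w => by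
    have h1 : inner ℝ ((tangentSpaceAt M x).starProjection g) (fderiv ℝ ψ (q x) w) =
        inner ℝ g (fderiv ℝ ψ (q x) w) := by
      rw [Submodule.inner_starProjection_left_eq_right,
        Submodule.starProjection_eq_self_iff.2 (h.fderiv_mem_tangentSpaceAt w)]
    simp only [A, G, _root_.sub_apply, InnerProductSpace.toDual_apply_apply, h1, heq w,
      sub_self]
  -- Derivatives within `M` are not unique: `A` may be nonzero, yet it kills the range of `fderiv ℝ
  -- ψ (q x)`, and `ψ ∘ q` is the identity on `M` near `x`. This allows `φ'` to be exchanged for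
  -- `G`.
  have hA0 : HasFDerivWithinAt A (0 : EuclideanSpace ℝ (Fin d) →L[ℝ] ℝ) M x := by
    have hq := (h.contDiffAt_inverse.differentiableAt (by simp)).hasFDerivAt
    have hψ := (h.contDiffAt_param.differentiableAt (by simp)).hasFDerivAt
    have h1 : HasFDerivAt (fun y => A (ψ (q y)))
        (A.comp ((fderiv ℝ ψ (q x)).comp (fderiv ℝ q x))) x :=
      A.hasFDerivAt.comp x (hψ.comp x hq)
    have h2 : A.comp ((fderiv ℝ ψ (q x)).comp (fderiv ℝ q x)) = 0 := by
      ext v; exact hA _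
    rw [h2] at h1
    refine h1.hasFDerivWithinAt.congr_of_eventuallyEq ?_ (by rw [h.param_inverse_self])
    filter_upwards [h.param_inverse] with y hy
    rw [hy]
  have h3 := (hφ.add A.hasFDerivWithinAt).sub hA0
  have h4 : φ' + A - 0 = G := by simp [A]
  rw [h4] at h3
  exact h3.congr_of_eventuallyEq (.of_forall fun y => by simp) (by simp)

/-- If a smooth function touches `φ` from above at `x` along `M`, then both have the same
derivative along `M`. -/
lemma IsLocalParametrization.apply_fderiv_eq_of_le (h : IsLocalParametrization M L ψ q x)
    {φ f : EuclideanSpace ℝ (Fin d) → ℝ} {φ' : EuclideanSpace ℝ (Fin d) →L[ℝ] ℝ}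
    (hφ : HasFDerivWithinAt φ φ' M x) (hf : HasGradientAt f g x) {b : ℝ}
    (hle : ∀ y ∈ M, φ y + b ≤ f y) (hx : φ x + b = f x) (w : L) :
    φ' (fderiv ℝ ψ (q x) w) = inner ℝ g (fderiv ℝ ψ (q x) w) := by
  obtain ⟨γ, -, hγ0, hγM, hγ⟩ := h.exists_curve w
  have h1 : HasDerivAt (φ ∘ γ) (φ' (fderiv ℝ ψ (q x) w)) 0 := by
    have : HasDerivWithinAt (φ ∘ γ) (φ' (fderiv ℝ ψ (q x) w)) (γ ⁻¹' M) 0 :=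
      HasFDerivWithinAt.comp_hasDerivWithinAt (t := M) 0 (hγ0.symm ▸ hφ) hγ.hasDerivWithinAt
        (Set.mapsTo_preimage _ _)
    exact this.hasDerivAt hγM
  have h2 : HasDerivAt (f ∘ γ) (inner ℝ g (fderiv ℝ ψ (q x) w)) 0 := by
    have hf' := hf.hasFDerivAt
    rw [← hγ0] at hf'
    exact hf'.comp_hasDerivAt 0 hγ
  have hmin : IsLocalMin ((f ∘ γ) - (φ ∘ γ)) 0 := by
    filter_upwards [hγM] with t ht
    have := hle _ ht
    simp only [Pi.sub_apply, Function.comp, hγ0]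
    linarith
  exact (sub_eq_zero.1 (hmin.hasDerivAt_eq_zero (h2.sub h1))).symm

end Submanifold

/-! ### Recovery of the tangential gradient. -/

section TangentialRecovery

variable {d m : ℕ} {K M : Set (EuclideanSpace ℝ (Fin d))}

/-- The `c`-transform of a continuous function is differentiable along a submanifold, almost
everywhere for any measure that the Hausdorff measure of the submanifold dominates. -/
lemma ae_differentiableWithinAt_cTransform [CompactSpace K] [Nonempty K]
    (hM : IsSmoothSubmanifold m M) {μ : Measure K}
    (hμM : μ.map Subtype.val ≪ (Measure.hausdorffMeasure (m : ℝ)).restrict M) (V : C(K, ℝ)) :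
    ∀ᵐ x : K ∂μ, (x : EuclideanSpace ℝ (Fin d)) ∈ M →
      DifferentiableWithinAt ℝ (cTransform (⇑V)) M x := by
  obtain ⟨R, hR⟩ := exists_norm_bound K
  have h0 := hM.hausdorffMeasure_not_differentiableWithinAt (lipschitzWith_cTransform_sub hR V)
  have h1 := measure_eq_zero_iff_ae_notMem.1
    (hμM (Measure.absolutelyContinuous_of_le Measure.restrict_le_self h0))
  filter_upwards [ae_of_ae_map measurable_subtype_coe.aemeasurable h1] with x hx hxM
  have h2 : DifferentiableWithinAt ℝ (fun y => cTransform V y - 1 / 2 * ‖y‖ ^ 2) M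
      (x : EuclideanSpace ℝ (Fin d)) := by
    by_contra h
    exact hx ⟨hxM, h⟩
  have h3 : Differentiable ℝ fun y : EuclideanSpace ℝ (Fin d) => 1 / 2 * ‖y‖ ^ 2 :=
    (contDiff_norm_sq ℝ (n := 1)).differentiable (by simp) |>.const_mul _
  exact (h2.add (h3 _).differentiableWithinAt).congr (fun y _ => by simp) (by simp)

lemma nullSingletonClass_of_absolutelyContinuous_hausdorffMeasure (hm : m ≠ 0) {μ : Measure K}
    (hμM : μ.map Subtype.val ≪ (Measure.hausdorffMeasure (m : ℝ)).restrict M) :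
    NullSingletonClass μ := by
  have := Measure.nullSingletonClass_hausdorff (EuclideanSpace ℝ (Fin d))
    (d := (m : ℝ)) (by positivity)
  refine ⟨fun x => ?_⟩
  have h := hμM (measure_singleton (x : EuclideanSpace ℝ (Fin d)))
  rw [Measure.map_apply measurable_subtype_coe (measurableSet_singleton _)] at h
  exact measure_mono_null (by simp) h

lemma differentiableAt_cost (x y : EuclideanSpace ℝ (Fin d)) :
    DifferentiableAt ℝ (fun z => cost z y) x := by
  have h : Differentiable ℝ fun z : EuclideanSpace ℝ (Fin d) => ‖z - y‖ ^ 2 :=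
    ((contDiff_norm_sq ℝ (n := 1)).comp (contDiff_id.sub contDiff_const)).differentiable (by simp)
  exact (h x).const_mul _

/-- At almost every point of the submanifold, the tangential gradient of the `c`-transform of a
semi-dual optimizer recovers the tangential part of the gradient of the cost at an optimal map. -/
theorem ae_hasTangentialGradientAt_cTransform [CompactSpace K] [Nonempty K]
    (hM : IsSmoothSubmanifold m M) {μ ν : ProbabilityMeasure K}
    (hμM : (μ : Measure K).map Subtype.val ≪ (Measure.hausdorffMeasure (m : ℝ)).restrict M)
    {V : C(K, ℝ)} (hV : IsOptimalPotential μ ν V) {T : K → K} (hT : IsOptimalMap μ ν T) :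
    ∀ᵐ x : K ∂(μ : Measure K), (x : EuclideanSpace ℝ (Fin d)) ∈ M →
      HasTangentialGradientAt M (cTransform V)
        ((tangentSpaceAt M x).starProjection
          (gradient (fun z => cost z (T x)) (x : EuclideanSpace ℝ (Fin d))))
        (x : EuclideanSpace ℝ (Fin d)) := by
  have hslack : m ≠ 0 → ∀ᵐ x : K ∂(μ : Measure K),
      conj V x + V (T x) = cost (x : EuclideanSpace ℝ (Fin d)) (T x) := fun hm => by
    have := nullSingletonClass_of_absolutelyContinuous_hausdorffMeasure hm hμM
    exact ae_conj_add_eq_cost hV hT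
  filter_upwards [ae_differentiableWithinAt_cTransform hM hμM V, eventually_imp_distrib_left.2 hslack]
    with x hdiff hx hxM
  obtain ⟨L, ψ, q, U, hL, -, hxU, hchart⟩ := hM.exists_isLocalParametrization hxM
  have hpar := hchart x hxU hxM
  have hφ := (hdiff hxM).hasFDerivWithinAt
  refine hpar.hasTangentialGradientAt hφ fun w => ?_
  -- For `m = 0` the measure may have atoms and slackness is not available, but the only tangent
  -- direction is zero.
  by_cases hm : m = 0
  · have : Subsingleton L := Module.finrank_zero_iff.1 (hL.trans hm)
    rw [Subsingleton.elim w 0]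
    simp
  · refine hpar.apply_fderiv_eq_of_le hφ (differentiableAt_cost _ _).hasGradientAt
      (b := V (T x)) (fun y _ => ?_) (hx hm) w
    linarith [cTransform_le V y (T x)]

end TangentialRecovery

end SemiDualOT

end

theorem proposition4p3 {d : ℕ} {K : Set (EuclideanSpace ℝ (Fin d))} (hK : IsCompact K)
    (ν μ : ProbabilityMeasure K) (με : ℝ → ProbabilityMeasure K)
    (hac : ∀ ε > 0, (με ε : Measure K).map Subtype.val ≪ volume)
    (hlim : Tendsto με (𝓝[>] 0) (𝓝 μ))
    (V : ℝ → C(K, ℝ)) (T : ℝ → K → K)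
    (hopt : ∀ ε > 0, SemiDualOT.IsOptimalPair (με ε) ν (V ε) (T ε))
    (m : ℕ) (M : Set (EuclideanSpace ℝ (Fin d))) (hMc : IsCompact M)
    (hM : SemiDualOT.IsSmoothSubmanifold m M)
    (hμM : (μ : Measure K).map Subtype.val ≪ (Measure.hausdorffMeasure (m : ℝ)).restrict M) :
    (∃ V₀ : C(K, ℝ), SemiDualOT.IsLimitingPotential V V₀) ∧
    ∀ V₀ : C(K, ℝ), SemiDualOT.IsLimitingPotential V V₀ →
      SemiDualOT.IsOptimalPotential μ ν V₀ ∧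
      ∀ Topt : K → K, SemiDualOT.IsOptimalMap μ ν Topt →
        ∀ᵐ x : K ∂(μ : Measure K), (x : EuclideanSpace ℝ (Fin d)) ∈ M →
          SemiDualOT.HasTangentialGradientAt M (SemiDualOT.cTransform V₀)
            ((SemiDualOT.tangentSpaceAt M x).starProjection
              (gradient (fun z => SemiDualOT.cost z (Topt x)) (x : EuclideanSpace ℝ (Fin d))))
            (x : EuclideanSpace ℝ (Fin d)) := by
  have : CompactSpace K := isCompact_iff_compactSpace.1 hK
  have : Nonempty K := nonempty_of_isProbabilityMeasure (μ : Measure K)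
  refine ⟨SemiDualOT.exists_isLimitingPotential V, fun V₀ hV₀ => ?_⟩
  have hV := hV₀.isOptimalPotential hlim fun ε hε => (hopt ε hε).potential
  exact ⟨hV, fun Topt hT => SemiDualOT.ae_hasTangentialGradientAt_cTransform hM hμM hV hT⟩
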